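/- **Conventions.** Let $\mathcal C$ be an abelian category. $\mathcal C$ is a *length category* if every object has a finite filtration whose successive quotients are simple. A *projective cover* of $X$ is an epimorphism $p\colon P\to X$ with $P$ projective which is essential: a morphism $a\colon Y\to P$ is an epimorphism whenever $p\circ a$ is. *Injective envelopes* are defined dually. $\mathcal C$ *has enough projectives* (resp. *injectives*) if every object has a projective cover (resp. an injective envelope). $\mathcal C$ is *$\mathrm{Ext}^1$-finite* if $\dim_{\mathrm{End}_{\mathcal C}(B)}\mathrm{Ext}^1_{\mathcal C}(A,B)<\infty$ for all simple objects $A,B$ of $\mathcal C$. A *recollement* of abelian categories consists of abelian categories $\mathcal A_Z,\mathcal A,\mathcal A_U$ and functors $i_*\colon\mathcal A_Z\to\mathcal A$, $i^*,i^!\colon\mathcal A\to\mathcal A_Z$, $j^*\colon\mathcal A\to\mathcal A_U$, $j_!,j_*\colon\mathcal A_U\to\mathcal A$ such that $(i^*,i_*,i^!)$ and $(j_!,j^*,j_*)$ are adjoint triples; $i_*,j_!,j_*$ are fully faithful; $j^*i_*=0$; and for every $X\in\mathcal A$ the adjunction maps give exact sequences $j_!j^*X\to X\to i_*i^*X\to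 0$ and $0\to i_*i^!X\to X\to j_*j^*X$. A *stratification* of an abelian category $\mathcal A$ by a non-empty poset $\Lambda$ consists of an abelian category $\mathcal A_{\Lambda'}$ for every lower subset $\Lambda'\subseteq\Lambda$, a fully faithful functor $\mathcal A_{\Lambda''}\hookrightarrow\mathcal A_{\Lambda'}$ for all lower subsets $\Lambda''\subseteq\Lambda'$, and an abelian category $\mathcal A_\lambda$ (a *strata category*) for every $\lambda\in\Lambda$, such that 1. $\mathcal A_\emptyset=0$ and $\mathcal A_\Lambda=\mathcal A$ (up to equivalence); 2. if $\lambda$ is a maximal element of a lower subset $\Lambda'$, then $\mathcal A_{\Lambda'\setminus\{\lambda\}}\hookrightarrow\mathcal A_{\Lambda'}$ is the functor $i_*$ of a (chosen) recollement with $\mathcal A_Z=\mathcal A_{\Lambda'\setminus\{\lambda\}}$, with $\mathcal A_{\Lambda'}$ in the middle, and with $\mathcal A_U=\mathcal A_\lambda$; 3. if $\Lambda''\subseteq\Lambda'$ are lower subsets and $\lambda$ is a maximal element of both, then the composite $\mathcal A_{\Lambda''}\hookrightarrow\mathcal A_{\Lambda'}\xrightarrow{j^*}\mathcal A_\lambda$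 is isomorphic to $j^*\colon\mathcal A_{\Lambda''}\to\mathcal A_\lambda$. **Statement.** Let $\mathcal A$ be an abelian category with a stratification by a finite non-empty poset $\Lambda$ in which every strata category $\mathcal A_\lambda$ is a length category and has, up to isomorphism, only finitely many simple objects. (a) If $\mathcal A$ is $\mathrm{Ext}^1$-finite, then $\mathcal A$ has enough projectives if and only if every strata category $\mathcal A_\lambda$ has enough projectives. (b) If $\mathcal A^{\mathrm{op}}$ is $\mathrm{Ext}^1$-finite, then $\mathcal A$ has enough injectives if and only if every strata category $\mathcal A_\lambda$ has enough injectives. -/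

import Mathlib

open CategoryTheory CategoryTheory.Limits

set_option linter.checkUnivs false

universe v u v₁ u₁ v₂ u₂ w

namespace AbStrat

/-! ### Length categories, simple objects, projective covers -/

section Basic

variable {C : Type u} [Category.{v} C] [Abelian C]

/-- `X` has a finite filtration `0 = X₀ ⊆ X₁ ⊆ ⋯ ⊆ Xₙ = X` whose successive quotients are simple,
built one step at a time. -/
inductive HasSimpleFiltration : C → Prop
  | zero {X : C} (hX : IsZero X) : HasSimpleFiltration X
  | step {X Y : C} (f : X ⟶ Y) (hf : Mono f) (hX : HasSimpleFiltration X)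
      (hs : Simple (cokernel f)) : HasSimpleFiltration Y

variable (C) in
/-- A length category: every object has a finite filtration by simple objects. -/
def IsLengthCategory : Prop := ∀ X : C, HasSimpleFiltration X

variable (C) in
/-- There are only finitely many simple objects up to isomorphism. -/
def HasFinitelyManySimples : Prop :=
  ∃ (n : ℕ) (L : Fin n → C), ∀ X : C, Simple X → ∃ i, Nonempty (X ≅ L i)

/-- `p : P ⟶ X` is a projective cover: `P` is projective and `p` is an essential surjection. -/
structure IsProjectiveCover {P X : C} (p : P ⟶ X) : Prop where
  projective : Projective P
  epi : Epi p
  essential : ∀ {Y : C} (a : Y ⟶ P), Epi (a ≫ p) → Epi a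

/-- `i : X ⟶ I` is an injective envelope: `I` is injective and `i` is an essential extension. -/
structure IsInjectiveEnvelope {X I : C} (i : X ⟶ I) : Prop where
  injective : Injective I
  mono : Mono i
  essential : ∀ {Y : C} (a : I ⟶ Y), Mono (i ≫ a) → Mono a

variable (C) in
/-- Every object has a projective cover. -/
def HasProjectiveCovers : Prop :=
  ∀ X : C, ∃ (P : C) (p : P ⟶ X), IsProjectiveCover p

variable (C) in
/-- Every object has an injective envelope. -/
def HasInjectiveEnvelopes : Prop :=
  ∀ X : C, ∃ (I : C) (i : X ⟶ I), IsInjectiveEnvelope i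

/-! ### Ext-finiteness -/

/-- The left `End B`-module structure on `Ext A B k` given by postcomposition
(multiplication in `End B` is composition of maps, `f * g = g ≫ f`). -/
@[reducible]
noncomputable def extModule [HasExt.{w} C] (A B : C) (k : ℕ) :
    Module (End B) (Abelian.Ext.{w} A B k) where
  smul f e := e.comp (Abelian.Ext.mk₀ f) (add_zero k)
  one_smul e := Abelian.Ext.comp_mk₀_id e
  mul_smul f g e := by
    change e.comp (Abelian.Ext.mk₀ (g ≫ f)) (add_zero k) =
      (e.comp (Abelian.Ext.mk₀ g) (add_zero k)).comp (Abelian.Ext.mk₀ f) (add_zero k)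
    rw [Abelian.Ext.comp_assoc_of_second_deg_zero, Abelian.Ext.mk₀_comp_mk₀]
  smul_zero f := by
    change (0 : Abelian.Ext.{w} A B k).comp (Abelian.Ext.mk₀ f) (add_zero k) = 0
    rw [Abelian.Ext.zero_comp]
  smul_add f e e' := Abelian.Ext.add_comp e e' (Abelian.Ext.mk₀ f) (add_zero k)
  add_smul f g e := by
    change e.comp (Abelian.Ext.mk₀ (f + g)) (add_zero k) =
      e.comp (Abelian.Ext.mk₀ f) (add_zero k) + e.comp (Abelian.Ext.mk₀ g) (add_zero k)
    rw [Abelian.Ext.mk₀_add, Abelian.Ext.comp_add]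
  zero_smul e := by
    change e.comp (Abelian.Ext.mk₀ 0) (add_zero k) = 0
    rw [Abelian.Ext.mk₀_zero, Abelian.Ext.comp_zero]

variable (C) in
/-- `C` is `Ext^k`-finite: for all simple objects `A`, `B`, the space `Ext^k(A, B)` is
finite-dimensional over the division ring `End B`. The instance `HasExt.standard` exists for every
abelian category. -/
def IsExtFinite (k : ℕ) : Prop :=
  letI : HasExt.{max u v} C := HasExt.standard C
  ∀ A B : C, Simple A → Simple B →
    letI := extModule A B k
    Module.Finite (End B) (Abelian.Ext.{max u v} A B k)

end Basic

/-! ### Recollements -/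

/-- The functor `i_* = iLow : AZ ⥤ A` fits into a recollement of abelian categories with
quotient `AU`. The names `iStar`, `iShriek`, `jShriek`, `jStar`, `jLow` stand for
`i^*`, `i^!`, `j_!`, `j^*`, `j_*`. -/
structure Recollement {AZ : Type u₁} [Category.{v₁} AZ] [Abelian AZ]
    {A : Type u} [Category.{v} A] [Abelian A] (iLow : AZ ⥤ A)
    (AU : Type u₂) [Category.{v₂} AU] [Abelian AU] where
  iStar : A ⥤ AZ
  iShriek : A ⥤ AZ
  jStar : A ⥤ AU
  jShriek : AU ⥤ A
  jLow : AU ⥤ A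
  /-- `i^*` is left adjoint to `i_*`. -/
  adjIStar : iStar ⊣ iLow
  /-- `i_*` is left adjoint to `i^!`. -/
  adjIShriek : iLow ⊣ iShriek
  /-- `j_!` is left adjoint to `j^*`. -/
  adjJShriek : jShriek ⊣ jStar
  /-- `j^*` is left adjoint to `j_*`. -/
  adjJLow : jStar ⊣ jLow
  iLow_full : iLow.Full
  iLow_faithful : iLow.Faithful
  jShriek_full : jShriek.Full
  jShriek_faithful : jShriek.Faithful
  jLow_full : jLow.Full
  jLow_faithful : jLow.Faithful
  /-- `j^* i_* = 0`. -/
  jStar_iLow : ∀ X : AZ, IsZero (jStar.obj (iLow.obj X))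
  /-- `j_! j^* X ⟶ X ⟶ i_* i^* X ⟶ 0` is exact. -/
  exact_right : ∀ X : A,
    (∃ w : adjJShriek.counit.app X ≫ adjIStar.unit.app X = 0,
      (ShortComplex.mk (adjJShriek.counit.app X) (adjIStar.unit.app X) w).Exact) ∧
    Epi (adjIStar.unit.app X)
  /-- `0 ⟶ i_* i^! X ⟶ X ⟶ j_* j^* X` is exact. -/
  exact_left : ∀ X : A,
    (∃ w : adjIShriek.counit.app X ≫ adjJLow.unit.app X = 0,
      (ShortComplex.mk (adjIShriek.counit.app X) (adjJLow.unit.app X) w).Exact) ∧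
    Mono (adjIShriek.counit.app X)

/-! ### Stratifications -/

/-- The lower set `s \ {l}`, for a maximal element `l` of the lower set `s`. -/
def removeMaximal {Λ : Type w} [PartialOrder Λ] (s : LowerSet Λ) (l : Λ)
    (h : Maximal (· ∈ s) l) : LowerSet Λ where
  carrier := {m | m ∈ s ∧ m ≠ l}
  lower' := by
    rintro a b hba ⟨ha, hal⟩
    refine ⟨s.lower hba ha, ?_⟩
    rintro rfl
    exact hal (le_antisymm (h.2 ha hba) hba)

theorem removeMaximal_le {Λ : Type w} [PartialOrder Λ] (s : LowerSet Λ) (l : Λ)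
    (h : Maximal (· ∈ s) l) : removeMaximal s l h ≤ s :=
  fun _ hm => hm.1

/-- A stratification of the abelian category `A` by the poset `Λ`. -/
structure Stratification (A : Type u) [Category.{v} A] [Abelian A]
    (Λ : Type w) [PartialOrder Λ] where
  /-- The category attached to a lower subset of `Λ`. -/
  cat : LowerSet Λ → Type u₁
  [catCategory : ∀ s, Category.{v₁} (cat s)]
  [catAbelian : ∀ s, Abelian (cat s)]
  /-- The embeddings between these categories. -/
  incl : ∀ {s t : LowerSet Λ}, s ≤ t → cat s ⥤ cat t
  incl_full : ∀ {s t : LowerSet Λ} (h : s ≤ t), (incl h).Full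
  incl_faithful : ∀ {s t : LowerSet Λ} (h : s ≤ t), (incl h).Faithful
  /-- The strata categories. -/
  stratum : Λ → Type u₂
  [stratumCategory : ∀ l, Category.{v₂} (stratum l)]
  [stratumAbelian : ∀ l, Abelian (stratum l)]
  /-- The category attached to the empty set is zero. -/
  cat_bot : ∀ X : cat ⊥, IsZero X
  /-- The category attached to `Λ` is `A`. -/
  catTop : cat ⊤ ≌ A
  /-- For `l` maximal in `s`, the embedding for `s \ {l} ⊆ s` fits into a recollement with
  quotient the stratum of `l`. -/
  recollement : ∀ (s : LowerSet Λ) (l : Λ) (h : Maximal (· ∈ s) l),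
    Recollement (incl (removeMaximal_le s l h)) (stratum l)
  /-- For `l` maximal in both `s ≤ t`, the quotient functors to the stratum of `l` are compatible
  with the embedding. -/
  incl_jStar : ∀ {s t : LowerSet Λ} (hst : s ≤ t) (l : Λ) (hs : Maximal (· ∈ s) l)
    (ht : Maximal (· ∈ t) l),
    Nonempty (incl hst ⋙ (recollement t l ht).jStar ≅ (recollement s l hs).jStar)

attribute [instance] Stratification.catCategory Stratification.catAbelian
  Stratification.stratumCategory Stratification.stratumAbelian

end AbStrat

set_option linter.unusedSectionVars false

/-! Part (b) is part (a) for the opposite stratification. For (a), adding or removing one maximal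
element of a lower set at a time reduces everything to a single recollement, whose middle category
is again a length category (`Recollement.isLengthCategory`).

Covers descend: `i^*` preserves projectives and epimorphisms, which settles the closed part. For the
open part, if `P` is a projective cover of `j_! X`, then the counit `j_! j^* P ⟶ P` is a split
epimorphism, and `j^* P` is projective and covers `X`.

Covers ascend by a length bound. Let `P` be projective in the closed part and `E ⟶ i_* P` an
essential epimorphism with kernel `K`. No simple quotient of `K` is killed by `j^*`, so each is one
of finitely many `S b`, covered by projectives `Q b` of the form `j_!` of a projective. Maps `E ⟶ S
b` vanish on `K`, so `Hom(K, S b)` embeds in `Ext¹(i_* P, S b)`, of finite dimension. Hence `K` is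
covered by boundedly many copies of the `Q b`, the length of `E` is bounded, and an `E` of maximal
length is a projective cover. A general `Y` is then covered using `j_! j^* Y ⟶ Y ⟶ i_* i^* Y ⟶ 0`.

`Ext¹`-finiteness is assumed for the whole category only. What passes to the smaller categories is
its consequence `HasBoundedExtensions`, stated with Hom sets alone. -/

namespace AbStrat

/-! ### Objects of finite length -/

section Length

variable {C : Type u} [Category.{v} C] [Abelian C]

/-- `X` has a finite filtration with at most `n` simple subquotients. -/
inductive LengthLE : ℕ → C → Prop
  | zero {n : ℕ} {X : C} (hX : IsZero X) : LengthLE n X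
  | step {n : ℕ} {X Y : C} (f : X ⟶ Y) (hf : Mono f) (hX : LengthLE n X)
      (hs : Simple (cokernel f)) : LengthLE (n + 1) Y

theorem hasSimpleFiltration_iff {X : C} : HasSimpleFiltration X ↔ ∃ n, LengthLE n X := by
  constructor
  · intro h
    induction h with
    | zero hX => exact ⟨0, .zero hX⟩
    | step f hf _ hs ih =>
      obtain ⟨n, hn⟩ := ih
      exact ⟨n + 1, .step f hf hn hs⟩
  · rintro ⟨n, h⟩
    induction h with
    | zero hX => exact .zero hX
    | step f hf _ hs ih => exact .step f hf ih hs

theorem LengthLE.mono {m n : ℕ} {X : C} (h : LengthLE m X) (hmn : m ≤ n) : LengthLE n X := by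
  induction h generalizing n with
  | zero hX => exact .zero hX
  | step f hf _ hs ih =>
    obtain ⟨k, rfl⟩ : ∃ k, n = k + 1 := ⟨n - 1, by omega⟩
    exact .step f hf (ih (by omega)) hs

/-- The cokernel of the kernel of an epimorphism is its target. -/
noncomputable def cokernelKernelIso {X Y : C} (p : X ⟶ Y) [Epi p] :
    cokernel (kernel.ι p) ≅ Y :=
  IsColimit.coconePointUniqueUpToIso (colimit.isColimit _)
    (Abelian.epiIsCokernelOfKernel _ (kernelIsKernel p))

theorem LengthLE.of_kernel {n : ℕ} {X S : C} (p : X ⟶ S) [Epi p] [Simple S]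
    (h : LengthLE n (kernel p)) : LengthLE (n + 1) X :=
  .step (kernel.ι p) inferInstance h (Simple.of_iso (cokernelKernelIso p))

/-- Either `T` lies in the last step `X` of the filtration, or `T` maps onto the simple quotient and
`T ∩ X` is handled by induction; if moreover `T ∩ X = X`, then `T = Y`. -/
theorem LengthLE.sub {n : ℕ} {T Y : C} (h : LengthLE n Y) (g : T ⟶ Y) [Mono g] :
    LengthLE n T ∧ (¬ IsIso g → ∃ m < n, LengthLE m T) := by
  induction h generalizing T with
  | zero hX =>
    have hT : IsZero T := hX.of_mono g
    exact ⟨.zero hT, fun hg => (hg (isIso_of_isInitial hT.isInitial hX.isInitial g)).elim⟩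
  | @step n X Y f hf hX hs ih =>
    by_cases hh : g ≫ cokernel.π f = 0
    · let l : T ⟶ X := Abelian.monoLift f g hh
      have hl : l ≫ f = g := Abelian.monoLift_comp f g hh
      have : Mono l := mono_of_mono_fac hl
      have := (ih l).1
      exact ⟨this.mono (by omega), fun _ => ⟨n, by omega, this⟩⟩
    · have : Epi (g ≫ cokernel.π f) := epi_of_nonzero_to_simple hh
      let l : kernel (g ≫ cokernel.π f) ⟶ X :=
        Abelian.monoLift f (kernel.ι (g ≫ cokernel.π f) ≫ g) (by simp)
      have hl : l ≫ f = kernel.ι (g ≫ cokernel.π f) ≫ g := Abelian.monoLift_comp f _ _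
      have : Mono l := mono_of_mono_fac hl
      refine ⟨.of_kernel (g ≫ cokernel.π f) (ih l).1, fun hg => ?_⟩
      have hni : ¬ IsIso l := by
        intro _
        have : Epi g := by
          refine Preadditive.epi_of_cancel_zero _ fun {Z} c hc => ?_
          have hfc : f ≫ c = 0 := by
            rw [← cancel_epi l, ← Category.assoc, hl, Category.assoc, hc, comp_zero, comp_zero]
          have h1 := cokernel.π_desc f c hfc
          have h2 : cokernel.desc f c hfc = 0 := by
            rw [← cancel_epi (g ≫ cokernel.π f), Category.assoc, h1, hc, comp_zero]
          rw [← h1, h2, comp_zero]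
        exact hg (isIso_of_mono_of_epi g)
      obtain ⟨m, hm, h⟩ := (ih l).2 hni
      exact ⟨m + 1, by omega, .of_kernel (g ≫ cokernel.π f) h⟩

theorem LengthLE.quot {n : ℕ} {Y Z : C} (h : LengthLE n Y) (g : Y ⟶ Z) [Epi g] :
    LengthLE n Z ∧ (¬ IsIso g → ∃ m < n, LengthLE m Z) := by
  induction h generalizing Z with
  | zero hX =>
    have hT : IsZero Z := hX.of_epi g
    exact ⟨.zero hT, fun hg => (hg (isIso_of_isInitial hX.isInitial hT.isInitial g)).elim⟩
  | @step n X Y f hf hX hs ih =>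
    let e := factorThruImage (f ≫ g)
    let i := image.ι (f ≫ g)
    have hei : e ≫ i = f ≫ g := image.fac _
    by_cases hc : cokernel.π i = 0
    · have : Epi i := Preadditive.epi_of_cokernel_zero hc
      have : IsIso i := isIso_of_mono_of_epi i
      have := ((ih e).1.sub (inv i)).1
      exact ⟨this.mono (by omega), fun _ => ⟨n, by omega, this⟩⟩
    · let q : cokernel f ⟶ cokernel i := cokernel.desc f (g ≫ cokernel.π i) (by
        calc f ≫ g ≫ cokernel.π i = (e ≫ i) ≫ cokernel.π i := by rw [hei, Category.assoc]
          _ = 0 := by rw [Category.assoc, cokernel.condition, comp_zero])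
      have hq : cokernel.π f ≫ q = g ≫ cokernel.π i := cokernel.π_desc _ _ _
      have : Epi q := epi_of_epi_fac hq
      have hq0 : q ≠ 0 := by
        intro h0
        rw [h0, comp_zero] at hq
        exact hc ((cancel_epi g).1 (by rw [← hq, comp_zero]))
      have : IsIso q := isIso_of_epi_of_nonzero hq0
      have hs' : Simple (cokernel i) := Simple.of_iso (asIso q).symm
      refine ⟨.step i inferInstance (ih e).1 hs', fun hg => ?_⟩
      have hni : ¬ IsIso e := by
        intro _
        have : Mono g := by
          refine Preadditive.mono_of_cancel_zero _ fun {T} t ht => ?_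
          have h1 : t ≫ cokernel.π f = 0 := by
            rw [← cancel_mono q, Category.assoc, hq, ← Category.assoc, ht, zero_comp, zero_comp]
          have h2 := Abelian.monoLift_comp f t h1
          have h3 : Abelian.monoLift f t h1 = 0 := by
            rw [← cancel_mono e, ← cancel_mono i, Category.assoc, hei, ← Category.assoc, h2, ht]
            simp
          rw [← h2, h3, zero_comp]
        exact hg (isIso_of_mono_of_epi g)
      obtain ⟨m, hm, h⟩ := (ih e).2 hni
      exact ⟨m + 1, by omega, .step i inferInstance h hs'⟩

theorem LengthLE.of_iso {n : ℕ} {X Y : C} (h : LengthLE n X) (e : X ≅ Y) : LengthLE n Y :=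
  (h.quot e.hom).1

theorem LengthLE.of_simple (S : C) [Simple S] : LengthLE 1 S :=
  .of_kernel (𝟙 S) (.zero (isZero_kernel_of_mono _))

theorem LengthLE.ext {a c : ℕ} {X Y : C} (p : X ⟶ Y) [Epi p] (ha : LengthLE a (kernel p))
    (hc : LengthLE c Y) : LengthLE (a + c) X := by
  induction hc generalizing X with
  | zero hY =>
    have h0 : p = 0 := hY.eq_of_tgt _ _
    have : Epi (kernel.ι p) := by rw [h0]; infer_instance
    exact (ha.quot (kernel.ι p)).1.mono (by omega)
  | @step n Y' Y f hf hY' hs ih =>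
    let h := p ≫ cokernel.π f
    have hk : kernel.ι h ≫ p ≫ cokernel.π f = 0 := kernel.condition h
    let l : kernel h ⟶ Y' := Abelian.monoLift f (kernel.ι h ≫ p) (by simpa using hk)
    have hl : l ≫ f = kernel.ι h ≫ p := Abelian.monoLift_comp f _ _
    -- The preimage in `X` of the filtration step `Y'` is a pullback, so it maps onto `Y'`.
    have hpb : IsPullback (kernel.ι h) l p f := by
      refine ⟨⟨hl.symm⟩, ⟨PullbackCone.IsLimit.mk _ (fun s => kernel.lift h s.fst ?_) ?_ ?_ ?_⟩⟩
      · simp only [h]; rw [← Category.assoc, s.condition, Category.assoc, cokernel.condition, comp_zero]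
      · intro s; simp
      · intro s; rw [← cancel_mono f, Category.assoc, hl, ← Category.assoc, kernel.lift_ι, s.condition]
      · intro s m hm _; rw [← cancel_mono (kernel.ι h), hm, kernel.lift_ι]
    have : Epi l := by
      have := Abelian.epi_pullback_of_epi_f p f
      have e := hpb.isoPullback_hom_snd
      rw [← e]; infer_instance
    let k : kernel l ⟶ kernel p := kernel.lift p (kernel.ι l ≫ kernel.ι h) (by
      rw [Category.assoc, ← hl, ← Category.assoc, kernel.condition, zero_comp])
    have hkk : k ≫ kernel.ι p = kernel.ι l ≫ kernel.ι h := kernel.lift_ι _ _ _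
    have : Mono k := mono_of_mono_fac hkk
    have := ih l (ha.sub k).1
    exact LengthLE.of_kernel h this

theorem LengthLE.exists_simple_quotient {n : ℕ} {X : C} (h : LengthLE n X) (hX : ¬ IsZero X) :
    ∃ (S : C) (p : X ⟶ S), Simple S ∧ Epi p := by
  cases h with
  | zero h => exact (hX h).elim
  | step f hf _ hs => exact ⟨_, cokernel.π f, hs, inferInstance⟩

/-- The least length of a filtration of `X` with simple subquotients. -/
noncomputable def length (X : C) : ℕ := sInf {n | LengthLE n X}

theorem LengthLE.length_le {n : ℕ} {X : C} (h : LengthLE n X) : length X ≤ n := Nat.sInf_le h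

theorem LengthLE.lengthLE_length {n : ℕ} {X : C} (h : LengthLE n X) : LengthLE (length X) X :=
  Nat.sInf_mem (s := {n | LengthLE n X}) ⟨n, h⟩

theorem LengthLE.length_lt_of_epi {n : ℕ} {X Y : C} (h : LengthLE n X) (p : X ⟶ Y) [Epi p]
    (hp : ¬ IsIso p) : length Y < length X := by
  obtain ⟨m, hm, h⟩ := (h.lengthLE_length.quot p).2 hp
  exact h.length_le.trans_lt hm

theorem LengthLE.isIso_of_epi_end {n : ℕ} {X : C} (h : LengthLE n X) (p : X ⟶ X) [Epi p] :
    IsIso p := by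
  by_contra hp
  exact (h.length_lt_of_epi p hp).false

end Length
-- Essential epimorphisms and projective covers
section Essential

variable {C : Type u} [Category.{v} C] [Abelian C]

/-- An essential epimorphism: an epimorphism that no proper subobject of the source still
covers the target by. -/
structure EssentialEpi {E X : C} (p : E ⟶ X) : Prop where
  epi : Epi p
  essential : ∀ {Y : C} (a : Y ⟶ E), Epi (a ≫ p) → Epi a

theorem EssentialEpi.id (X : C) : EssentialEpi (𝟙 X) :=
  ⟨inferInstance, fun a h => by simpa using h⟩

theorem EssentialEpi.comp {D E X : C} {q : D ⟶ E} {p : E ⟶ X} (hq : EssentialEpi q)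
    (hp : EssentialEpi p) : EssentialEpi (q ≫ p) := by
  have := hq.epi
  have := hp.epi
  exact ⟨epi_comp _ _, fun a h => hq.essential a (hp.essential (a ≫ q) (by simpa using h))⟩

theorem EssentialEpi.of_comp {D E X : C} {q : D ⟶ E} {p : E ⟶ X} [Epi q]
    (h : EssentialEpi (q ≫ p)) : EssentialEpi p := by
  have := h.epi
  refine ⟨epi_of_epi q p, fun {Y} a ha => ?_⟩
  have h1 : Epi (pullback.fst a q) := Abelian.epi_pullback_of_epi_g a q
  have h2 : Epi (pullback.snd a q ≫ q ≫ p) := by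
    rw [← Category.assoc, ← pullback.condition, Category.assoc]
    exact epi_comp _ _
  have h3 : Epi (pullback.snd a q) := h.essential _ h2
  have h4 : Epi (pullback.fst a q ≫ a) := by
    rw [pullback.condition]
    exact epi_comp _ _
  exact epi_of_epi (pullback.fst a q) a

theorem EssentialEpi.isIso_of_section {E X : C} {p : E ⟶ X} (h : EssentialEpi p) (s : X ⟶ E)
    (hs : s ≫ p = 𝟙 X) : IsIso p := by
  have : Epi s := h.essential s (by rw [hs]; infer_instance)
  have : IsSplitMono s := ⟨⟨⟨p, hs⟩⟩⟩
  have : IsIso s := isIso_of_epi_of_isSplitMono s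
  have : p = inv s := by rw [← cancel_epi s, hs, IsIso.hom_inv_id]
  rw [this]; infer_instance

theorem LengthLE.exists_essentialEpi {n : ℕ} {Y X : C} (h : LengthLE n Y) (p : Y ⟶ X) [Epi p] :
    ∃ (Y' : C) (m : Y' ⟶ Y), Mono m ∧ EssentialEpi (m ≫ p) := by
  induction n using Nat.strong_induction_on generalizing Y with
  | _ n ih =>
    by_cases hp : EssentialEpi p
    · exact ⟨Y, 𝟙 Y, inferInstance, by simpa using hp⟩
    · have : ∃ (Z : C) (a : Z ⟶ Y), Epi (a ≫ p) ∧ ¬ Epi a := by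
        by_contra hcon
        push Not at hcon
        exact hp ⟨inferInstance, fun a ha => hcon _ a ha⟩
      obtain ⟨Z, a, hap, ha⟩ := this
      have hi : ¬ IsIso (image.ι a) := fun _ => ha (by rw [← image.fac a]; exact epi_comp _ _)
      obtain ⟨m, hm, h'⟩ := (h.sub (image.ι a)).2 hi
      have : Epi (image.ι a ≫ p) := by
        have : Epi (factorThruImage a ≫ image.ι a ≫ p) := by rwa [image.fac_assoc]
        exact epi_of_epi (factorThruImage a) _
      obtain ⟨Y', k, hk, hk'⟩ := ih m hm h' (image.ι a ≫ p)
      exact ⟨Y', k ≫ image.ι a, mono_comp _ _, by simpa using hk'⟩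

theorem projective_of_splits {E : C} (h : ∀ {Y : C} (p : Y ⟶ E), Epi p → ∃ s, s ≫ p = 𝟙 E) :
    Projective E where
  factors {X Y} f e _ := by
    obtain ⟨s, hs⟩ := h (pullback.fst f e) (Abelian.epi_pullback_of_epi_g f e)
    exact ⟨s ≫ pullback.snd f e, by
      rw [Category.assoc, ← pullback.condition, ← Category.assoc, hs, Category.id_comp]⟩

theorem isProjectiveCover_iff {P X : C} (p : P ⟶ X) :
    IsProjectiveCover p ↔ Projective P ∧ EssentialEpi p :=
  ⟨fun h => ⟨h.projective, h.epi, h.essential⟩, fun h => ⟨h.1, h.2.epi, h.2.essential⟩⟩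

/-- A subobject `Q` of `P` that is essential over `X` is a retract of `P`: lifting `p` to `P ⟶ Q`
and restricting to `Q` gives an epic endomorphism, invertible by finite length. -/
theorem LengthLE.exists_isProjectiveCover {n : ℕ} {P X : C} (h : LengthLE n P) [Projective P]
    (p : P ⟶ X) [Epi p] : ∃ (Q : C) (q : Q ⟶ X), IsProjectiveCover q := by
  obtain ⟨Q, m, hm, hess⟩ := h.exists_essentialEpi p
  have := hess.epi
  have hf : Projective.factorThru p (m ≫ p) ≫ m ≫ p = p := Projective.factorThru_comp _ _
  set f := Projective.factorThru p (m ≫ p)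
  have hf' : Epi f := hess.essential f (by rw [hf]; infer_instance)
  have hmf : Epi (m ≫ f) := hess.essential _ (by rw [Category.assoc, hf]; infer_instance)
  have : IsIso (m ≫ f) := (h.sub m).1.isIso_of_epi_end _
  have hQ : Projective Q := by
    refine Retract.projective (X := Q) (Y := P) ?_
    exact { i := m, r := f ≫ inv (m ≫ f), retract := by rw [← Category.assoc]; simp }
  exact ⟨Q, m ≫ p, (isProjectiveCover_iff _).2 ⟨hQ, hess⟩⟩

theorem hasProjectiveCovers_of_length (hC : IsLengthCategory C)
    (h : ∀ X : C, ∃ (P : C) (p : P ⟶ X), Projective P ∧ Epi p) : HasProjectiveCovers C := by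
  intro X
  obtain ⟨P, p, _, _⟩ := h X
  obtain ⟨n, hn⟩ := hasSimpleFiltration_iff.1 (hC P)
  exact hn.exists_isProjectiveCover p

/-- Take `E` essential over `X` of maximal length. Any epimorphism onto `E` restricts to an
essential one, whose source is also essential over `X`; by maximality this restriction is
invertible, so the epimorphism splits. -/
theorem exists_isProjectiveCover_of_bounded (hC : IsLengthCategory C) {X : C} {N : ℕ}
    (hN : ∀ {E : C} (p : E ⟶ X), EssentialEpi p → LengthLE N E) :
    ∃ (P : C) (p : P ⟶ X), IsProjectiveCover p := by
  let s : Set ℕ := {n | ∃ (E : C) (p : E ⟶ X), EssentialEpi p ∧ length E = n}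
  have hs : s.Nonempty := ⟨_, X, 𝟙 X, EssentialEpi.id X, rfl⟩
  have hb : BddAbove s := ⟨N, by rintro _ ⟨E, p, hp, rfl⟩; exact (hN p hp).length_le⟩
  obtain ⟨E, p, hp, hE⟩ := Nat.sSup_mem hs hb
  refine ⟨E, p, (isProjectiveCover_iff p).2 ⟨projective_of_splits fun {Y} q hq => ?_, hp⟩⟩
  obtain ⟨n, hn⟩ := hasSimpleFiltration_iff.1 (hC Y)
  obtain ⟨Y', m, hm, hess⟩ := hn.exists_essentialEpi q
  have := hess.epi
  have hiso : IsIso (m ≫ q) := by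
    by_contra hni
    have h1 := (hn.sub m).1.length_lt_of_epi (m ≫ q) hni
    have h2 : length Y' ≤ sSup s := le_csSup hb ⟨Y', _, hess.comp hp, rfl⟩
    omega
  exact ⟨inv (m ≫ q) ≫ m, by rw [Category.assoc, IsIso.inv_hom_id]⟩

/-- Otherwise `kernel p` maps onto `S`, so `kernel p` and `kernel f` span `E`; then `kernel f`
covers `X`, and essentiality forces `f = 0`. -/
theorem EssentialEpi.kernel_comp_eq_zero {E X S : C} [Simple S] {p : E ⟶ X} (hp : EssentialEpi p)
    (f : E ⟶ S) : kernel.ι p ≫ f = 0 := by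
  by_contra h
  have h1 : Epi (kernel.ι p ≫ f) := epi_of_nonzero_to_simple h
  have h2 : Epi (kernel.ι f ≫ p) := by
    have := hp.epi
    refine Preadditive.epi_of_cancel_zero _ fun {Z} c hc => ?_
    have : Epi f := epi_of_nonzero_to_simple (by rintro rfl; simp at h)
    have hf := Abelian.comp_epiDesc f (p ≫ c) (by simpa using hc)
    have h0 : Abelian.epiDesc f (p ≫ c) (by simpa using hc) = 0 := by
      rw [← cancel_epi (kernel.ι p ≫ f), Category.assoc, hf]
      simp
    rw [← cancel_epi p, ← hf, h0]
    simp
  have h3 : Epi (kernel.ι f) := hp.essential _ h2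
  have h4 : f = 0 := by rw [← cancel_epi (kernel.ι f)]; simp
  exact h (by rw [h4, comp_zero])

end Essential

/-! ### Transport along exact functors and equivalences -/

section Transport

variable {C : Type u} [Category.{v} C] [Abelian C] {D : Type u₁} [Category.{v₁} D] [Abelian D]

theorem LengthLE.map (F : C ⥤ D) [PreservesFiniteLimits F] [PreservesFiniteColimits F]
    (hF : ∀ S : C, Simple S → Simple (F.obj S)) {n : ℕ} {X : C} (h : LengthLE n X) :
    LengthLE n (F.obj X) := by
  have : F.PreservesZeroMorphisms := Functor.preservesZeroMorphisms_of_preserves_terminal_object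
  induction h with
  | zero hX => exact .zero (F.map_isZero hX)
  | step f hf _ hs ih =>
    have := hF _ hs
    exact .step (F.map f) inferInstance ih (Simple.of_iso (PreservesCokernel.iso F f).symm)

theorem IsLengthCategory.of_equivalence (h : IsLengthCategory C) (e : C ≌ D) :
    IsLengthCategory D := by
  intro X
  obtain ⟨n, hn⟩ := hasSimpleFiltration_iff.1 (h (e.inverse.obj X))
  exact hasSimpleFiltration_iff.2 ⟨n, (hn.map e.functor fun S _ => simple_obj e.functor S).of_iso
    (e.counitIso.app X)⟩

theorem HasProjectiveCovers.of_equivalence (hC : IsLengthCategory C) (h : HasProjectiveCovers C)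
    (e : C ≌ D) : HasProjectiveCovers D := by
  refine hasProjectiveCovers_of_length (hC.of_equivalence e) fun X => ?_
  obtain ⟨P, p, hp⟩ := h (e.inverse.obj X)
  have := hp.epi
  exact ⟨e.functor.obj P, e.functor.map p ≫ e.counit.app X,
    (e.map_projective_iff P).2 hp.projective, epi_comp _ _⟩

end Transport
end AbStrat

namespace AbStrat
-- Length in a recollement, and descent of projective covers
namespace Recollement

variable {AZ : Type u₁} [Category.{v₁} AZ] [Abelian AZ] {A : Type u} [Category.{v} A] [Abelian A]
  {iLow : AZ ⥤ A} {AU : Type u₂} [Category.{v₂} AU] [Abelian AU]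

theorem preservesFiniteLimits_iLow (R : Recollement iLow AU) : PreservesFiniteLimits iLow := by
  have := R.adjIStar.rightAdjoint_preservesLimits.{0, 0}
  infer_instance

theorem preservesFiniteColimits_iLow (R : Recollement iLow AU) : PreservesFiniteColimits iLow := by
  have := R.adjIShriek.leftAdjoint_preservesColimits.{0, 0}
  infer_instance

instance (R : Recollement iLow AU) : PreservesFiniteLimits R.jStar := by
  have := R.adjJShriek.rightAdjoint_preservesLimits.{0, 0}
  infer_instance

instance (R : Recollement iLow AU) : PreservesFiniteColimits R.jStar := by
  have := R.adjJLow.leftAdjoint_preservesColimits.{0, 0}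
  infer_instance

instance (R : Recollement iLow AU) : PreservesFiniteColimits R.jShriek := by
  have := R.adjJShriek.leftAdjoint_preservesColimits.{0, 0}
  infer_instance

instance (R : Recollement iLow AU) : PreservesFiniteColimits R.iStar := by
  have := R.adjIStar.leftAdjoint_preservesColimits.{0, 0}
  infer_instance

instance (R : Recollement iLow AU) : R.jStar.PreservesZeroMorphisms :=
  Functor.preservesZeroMorphisms_of_preserves_terminal_object

instance (R : Recollement iLow AU) : R.jShriek.PreservesZeroMorphisms :=
  Functor.preservesZeroMorphisms_of_preserves_initial_object

instance (R : Recollement iLow AU) : R.jShriek.Full := R.jShriek_full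
instance (R : Recollement iLow AU) : R.jShriek.Faithful := R.jShriek_faithful
instance (R : Recollement iLow AU) : R.jLow.Full := R.jLow_full
instance (R : Recollement iLow AU) : R.jLow.Faithful := R.jLow_faithful

theorem isIso_unit_of_isZero (R : Recollement iLow AU) {X : A} (hX : IsZero (R.jStar.obj X)) :
    IsIso (R.adjIStar.unit.app X) := by
  obtain ⟨⟨w, hex⟩, hepi⟩ := R.exact_right X
  have h0 : R.adjJShriek.counit.app X = 0 := (R.jShriek.map_isZero hX).eq_of_src _ _
  have : Mono (R.adjIStar.unit.app X) := hex.mono_g h0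
  exact isIso_of_mono_of_epi _

/-- An object killed by `j^*` comes from the closed part. -/
noncomputable def isoOfIsZero (R : Recollement iLow AU) {X : A} (hX : IsZero (R.jStar.obj X)) :
    X ≅ iLow.obj (R.iStar.obj X) :=
  have := R.isIso_unit_of_isZero hX
  asIso (R.adjIStar.unit.app X)

theorem eq_zero_of_isZero_of_jLow (R : Recollement iLow AU)
    {X : A} (hX : IsZero (R.jStar.obj X)) {Y : AU}
    (f : X ⟶ R.jLow.obj Y) : f = 0 :=
  (R.adjJLow.homEquiv X Y).symm.injective (hX.eq_of_src _ _)

theorem eq_zero_of_jShriek_of_isZero (R : Recollement iLow AU)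
    {X : A} (hX : IsZero (R.jStar.obj X)) {Y : AU}
    (f : R.jShriek.obj Y ⟶ X) : f = 0 :=
  (R.adjJShriek.homEquiv Y X).injective (hX.eq_of_tgt _ _)

theorem isZero_jStar_of_mono (R : Recollement iLow AU)
    {X Y : A} (f : X ⟶ Y) [Mono f] (hY : IsZero (R.jStar.obj Y)) :
    IsZero (R.jStar.obj X) :=
  hY.of_mono (R.jStar.map f)

theorem isZero_jStar_of_epi (R : Recollement iLow AU)
    {X Y : A} (f : X ⟶ Y) [Epi f] (hX : IsZero (R.jStar.obj X)) :
    IsZero (R.jStar.obj Y) :=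
  hX.of_epi (R.jStar.map f)

theorem isZero_jStar_cokernel (R : Recollement iLow AU)
    {X Y : A} (f : X ⟶ Y) [Epi (R.jStar.map f)] :
    IsZero (R.jStar.obj (cokernel f)) :=
  (isZero_cokernel_of_epi (R.jStar.map f)).of_iso (PreservesCokernel.iso R.jStar f)

theorem simple_iLow (R : Recollement iLow AU) (S : AZ) [Simple S] : Simple (iLow.obj S) := by
  have := R.iLow_full
  have := R.iLow_faithful
  have := R.preservesFiniteLimits_iLow
  have : iLow.PreservesZeroMorphisms :=
    Functor.preservesZeroMorphisms_of_preserves_terminal_object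
  constructor
  intro Y f hf
  let e := R.isoOfIsZero (R.isZero_jStar_of_mono f (R.jStar_iLow S))
  obtain ⟨g, hg⟩ := iLow.map_surjective (e.inv ≫ f)
  have : Mono (iLow.map g) := by rw [hg]; exact mono_comp _ _
  have : Mono g := iLow.mono_of_mono_map this
  have hf' : f = e.hom ≫ iLow.map g := by rw [hg, e.hom_inv_id_assoc]
  have h1 : IsIso f ↔ IsIso g := by
    rw [hf', isIso_comp_left_iff, isIso_iff_of_reflects_iso]
  have h2 : f = 0 ↔ g = 0 := by
    rw [hf']
    constructor
    · intro h
      apply iLow.map_injective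
      rw [← cancel_epi e.hom, h]; simp
    · rintro rfl
      simp
  rw [h1, Simple.mono_isIso_iff_nonzero, ne_eq, ne_eq, h2]

theorem exists_lengthLE_of_isZero (R : Recollement iLow AU) (hZ : IsLengthCategory AZ) {X : A}
    (hX : IsZero (R.jStar.obj X)) : ∃ n, LengthLE n X := by
  obtain ⟨n, hn⟩ := hasSimpleFiltration_iff.1 (hZ (R.iStar.obj X))
  have := R.preservesFiniteLimits_iLow
  have := R.preservesFiniteColimits_iLow
  exact ⟨n, (hn.map iLow fun S _ => R.simple_iLow S).of_iso (R.isoOfIsZero hX).symm⟩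

theorem exists_epi_kernel_unit (R : Recollement iLow AU) (X : A) :
    ∃ p : R.jShriek.obj (R.jStar.obj X) ⟶ kernel (R.adjIStar.unit.app X), Epi p := by
  obtain ⟨⟨w, hex⟩, hepi⟩ := R.exact_right X
  exact ⟨_, (ShortComplex.exact_iff_epi_kernel_lift _).1 hex⟩

theorem exists_lengthLE_of_mono_jLow (R : Recollement iLow AU)
    (hZ : IsLengthCategory AZ) {S : AU} [Simple S] {V : A}
    (i : V ⟶ R.jLow.obj S) [Mono i] : ∃ n, LengthLE n V := by
  obtain ⟨_, hepi⟩ := R.exact_right V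
  obtain ⟨c, hc⟩ := R.exists_lengthLE_of_isZero hZ (R.jStar_iLow (R.iStar.obj V))
  suffices ∃ a, LengthLE a (kernel (R.adjIStar.unit.app V)) by
    obtain ⟨a, ha⟩ := this
    exact ⟨_, ha.ext _ hc⟩
  by_cases hK : IsZero (kernel (R.adjIStar.unit.app V))
  · exact ⟨0, .zero hK⟩
  set K := kernel (R.adjIStar.unit.app V)
  obtain ⟨p, hp⟩ : ∃ p : R.jShriek.obj (R.jStar.obj V) ⟶ K, Epi p := R.exists_epi_kernel_unit V
  have hS : Simple (R.jStar.obj (R.jLow.obj S)) := Simple.of_iso (Y := S) (asIso (R.adjJLow.counit.app S))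
  -- `K` is a quotient of `j_! j^* V`, so it has no nonzero quotient killed by `j^*`, and a
  -- subobject of `j_* S`, so it has no nonzero subobject killed by `j^*`. As `j^* j_* S ≅ S` is
  -- simple, a nonzero `T ⊆ K` has `j^* T = j^* K`, hence `T = K`.
  have : Simple K := by
    constructor
    intro T f hf
    constructor
    · rintro h rfl
      exact hK ((IsZero.iff_id_eq_zero _).2 (by
        rw [← cancel_epi (0 : T ⟶ K)]; simp))
    · intro hf0
      have hg : R.jStar.map (f ≫ kernel.ι (R.adjIStar.unit.app V) ≫ i) ≠ 0 := by
        intro h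
        have h1 : IsZero (R.jStar.obj T) := IsZero.of_mono_eq_zero _ h
        have h2 := R.eq_zero_of_isZero_of_jLow h1
          (f ≫ kernel.ι (R.adjIStar.unit.app V) ≫ i)
        exact hf0 ((cancel_mono (kernel.ι (R.adjIStar.unit.app V) ≫ i)).1 (by rw [h2, zero_comp]))
      have h1 : IsIso (R.jStar.map (f ≫ kernel.ι (R.adjIStar.unit.app V) ≫ i)) :=
        isIso_of_mono_of_nonzero hg
      have h2 : Epi (R.jStar.map (kernel.ι (R.adjIStar.unit.app V) ≫ i)) := by
        rw [R.jStar.map_comp] at h1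
        exact epi_of_epi (R.jStar.map f) _
      have h3 : IsIso (R.jStar.map (kernel.ι (R.adjIStar.unit.app V) ≫ i)) :=
        isIso_of_mono_of_epi _
      rw [R.jStar.map_comp] at h1
      have h4 : IsIso (R.jStar.map f) :=
        IsIso.of_isIso_comp_right _ (R.jStar.map (kernel.ι (R.adjIStar.unit.app V) ≫ i))
      have h5 := R.isZero_jStar_cokernel f
      have h6 : p ≫ cokernel.π f = 0 := R.eq_zero_of_jShriek_of_isZero h5 _
      have h7 : cokernel.π f = 0 := by rw [← cancel_epi p, h6, comp_zero]
      have : Epi f := Preadditive.epi_of_cokernel_zero h7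
      exact isIso_of_mono_of_epi f
  exact ⟨1, .of_simple K⟩

/-- A simple quotient `j^* X ⟶ S` is adjoint to a map `X ⟶ j_* S`. Its image has finite length, and
`j^*` of its kernel lies in the kernel of `j^* X ⟶ S`, where induction applies. -/
theorem exists_lengthLE_of_jStar (R : Recollement iLow AU)
    (hZ : IsLengthCategory AZ) {n : ℕ} {X : A}
    (h : LengthLE n (R.jStar.obj X)) : ∃ m, LengthLE m X := by
  induction n generalizing X with
  | zero =>
    cases h with
    | zero h => exact R.exists_lengthLE_of_isZero hZ h
  | succ n ih =>
    generalize hY : R.jStar.obj X = Y at h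
    cases h with
    | zero h => subst hY; exact R.exists_lengthLE_of_isZero hZ h
    | @step _ Y' _ f hf hX hs =>
      subst hY
      let h := R.adjJLow.homEquiv _ _ (cokernel.π f)
      obtain ⟨c, hc⟩ := R.exists_lengthLE_of_mono_jLow hZ (image.ι h)
      have hk : R.jStar.map (kernel.ι (factorThruImage h)) ≫ cokernel.π f = 0 := by
        have h0 : kernel.ι (factorThruImage h) ≫ h = 0 := by
          calc _ = kernel.ι (factorThruImage h) ≫ factorThruImage h ≫ image.ι h := by rw [image.fac]
            _ = 0 := by rw [kernel.condition_assoc, zero_comp]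
        apply (R.adjJLow.homEquiv _ _).injective
        rw [Adjunction.homEquiv_naturality_left, h0]
        simp [Adjunction.homEquiv_unit]
      have hl := Abelian.monoLift_comp f _ hk
      have : Mono (Abelian.monoLift f _ hk) := mono_of_mono_fac hl
      obtain ⟨a, ha⟩ := ih (hX.sub (Abelian.monoLift f _ hk)).1
      exact ⟨_, ha.ext (factorThruImage h) hc⟩

theorem isLengthCategory (R : Recollement iLow AU)
    (hZ : IsLengthCategory AZ) (hU : IsLengthCategory AU) :
    IsLengthCategory A := fun X =>
  hasSimpleFiltration_iff.2 <|
    let ⟨_, h⟩ := hasSimpleFiltration_iff.1 (hU (R.jStar.obj X))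
    R.exists_lengthLE_of_jStar hZ h

theorem hasProjectiveCovers_closed (R : Recollement iLow AU)
    (hZ : IsLengthCategory AZ) (h : HasProjectiveCovers A) :
    HasProjectiveCovers AZ := by
  have := R.iLow_full
  have := R.iLow_faithful
  have := R.preservesFiniteColimits_iLow
  refine hasProjectiveCovers_of_length hZ fun X => ?_
  obtain ⟨P, p, hp⟩ := h (iLow.obj X)
  have := hp.epi
  have := hp.projective
  exact ⟨R.iStar.obj P, R.iStar.map p ≫ R.adjIStar.counit.app X,
    R.adjIStar.map_projective P inferInstance, epi_comp _ _⟩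

theorem hasProjectiveCovers_open (R : Recollement iLow AU)
    (hU : IsLengthCategory AU) (h : HasProjectiveCovers A) :
    HasProjectiveCovers AU := by
  refine hasProjectiveCovers_of_length hU fun X => ?_
  obtain ⟨P, p, hp⟩ := h (R.jShriek.obj X)
  have := hp.epi
  have := hp.projective
  obtain ⟨⟨w, hex⟩, hepi⟩ := R.exact_right P
  set ε := R.adjJShriek.counit.app P
  have h1 : Epi (ε ≫ p) := by
    -- The cokernel is a quotient of `i_* i^* P`, hence killed by `j^*`, and also a quotient of `j_!
    -- X`, hence zero.
    apply Preadditive.epi_of_cokernel_zero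
    have hc : ε ≫ p ≫ cokernel.π (ε ≫ p) = 0 := by
      rw [← Category.assoc, cokernel.condition]
    have hd : R.adjIStar.unit.app P ≫ hex.desc _ hc = p ≫ cokernel.π (ε ≫ p) := hex.g_desc _ hc
    have : Epi (hex.desc _ hc) := by
      have : Epi (R.adjIStar.unit.app P ≫ hex.desc _ hc) := by rw [hd]; exact epi_comp _ _
      exact epi_of_epi (R.adjIStar.unit.app P) _
    exact R.eq_zero_of_jShriek_of_isZero
      (R.isZero_jStar_of_epi (hex.desc _ hc) (R.jStar_iLow (R.iStar.obj P))) _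
  have h2 : Epi ε := hp.essential ε h1
  obtain ⟨s, hs⟩ : ∃ s, s ≫ ε = 𝟙 P := ⟨_, Projective.factorThru_comp (𝟙 P) ε⟩
  -- Both sides are inverse to `j^* ε`, which is invertible because `j_!` is fully faithful.
  have hu : R.adjJShriek.unit.app (R.jStar.obj P) = R.jStar.map s := by
    have h3 := R.adjJShriek.right_triangle_components P
    have h4 : R.jStar.map ε = inv (R.adjJShriek.unit.app (R.jStar.obj P)) :=
      (IsIso.inv_eq_of_hom_inv_id h3).symm
    have h5 : R.jStar.map s ≫ R.jStar.map ε = 𝟙 _ := by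
      rw [← R.jStar.map_comp, hs]; exact R.jStar.map_id P
    rw [h4, IsIso.comp_inv_eq, Category.id_comp] at h5
    exact h5.symm
  refine ⟨R.jStar.obj P, R.jStar.map p ≫ inv (R.adjJShriek.unit.app X), ⟨?_⟩, epi_comp _ _⟩
  intro Y Y' f e _
  let g : P ⟶ R.jShriek.obj Y := Projective.factorThru (s ≫ R.jShriek.map f) (R.jShriek.map e)
  have hg : g ≫ R.jShriek.map e = s ≫ R.jShriek.map f := Projective.factorThru_comp _ _
  refine ⟨R.jStar.map g ≫ inv (R.adjJShriek.unit.app Y), ?_⟩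
  have hn := R.adjJShriek.unit.naturality e
  have hf := R.adjJShriek.unit.naturality f
  simp only [Functor.id_obj, Functor.id_map, Functor.comp_obj, Functor.comp_map] at hn hf
  rw [← cancel_mono (R.adjJShriek.unit.app Y'), hf, hu, ← R.jStar.map_comp, ← hg, Category.assoc,
    Category.assoc, hn, IsIso.inv_hom_id_assoc, R.jStar.map_comp]

end Recollement
-- Consequences of `Ext¹`-finiteness
section Ext

variable {C : Type u} [Category.{v} C] [Abelian C]

theorem extModule_finite_of_shortExact [HasExt.{w} C] {S : ShortComplex C} (hS : S.ShortExact)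
    (B : C) [Simple B]
    (h₁ : letI := extModule S.X₁ B 1; Module.Finite (End B) (Abelian.Ext.{w} S.X₁ B 1))
    (h₃ : letI := extModule S.X₃ B 1; Module.Finite (End B) (Abelian.Ext.{w} S.X₃ B 1)) :
    letI := extModule S.X₂ B 1; Module.Finite (End B) (Abelian.Ext.{w} S.X₂ B 1) := by
  let := extModule S.X₁ B 1
  let := extModule S.X₂ B 1
  let := extModule S.X₃ B 1
  let f : Abelian.Ext.{w} S.X₃ B 1 →ₗ[End B] Abelian.Ext.{w} S.X₂ B 1 :=
    { (Abelian.Ext.mk₀ S.g).precomp B (zero_add 1) with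
      map_smul' := fun r x => (Abelian.Ext.comp_assoc_of_third_deg_zero _ x (Abelian.Ext.mk₀ r)
        (zero_add 1)).symm }
  let g : Abelian.Ext.{w} S.X₂ B 1 →ₗ[End B] Abelian.Ext.{w} S.X₁ B 1 :=
    { (Abelian.Ext.mk₀ S.f).precomp B (zero_add 1) with
      map_smul' := fun r x => (Abelian.Ext.comp_assoc_of_third_deg_zero _ x (Abelian.Ext.mk₀ r)
        (zero_add 1)).symm }
  have hfg : LinearMap.range f = LinearMap.ker g := by
    ext x
    constructor
    · rintro ⟨y, rfl⟩
      change (Abelian.Ext.mk₀ S.f).comp ((Abelian.Ext.mk₀ S.g).comp y (zero_add 1)) (zero_add 1) = 0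
      simp
    · exact Abelian.Ext.contravariant_sequence_exact₂ hS B x
  -- By Schur's lemma `End B` is a division ring, so the finite outer terms are Noetherian.
  have := isNoetherian_of_range_eq_ker f g hfg
  infer_instance

theorem extModule_finite_of_lengthLE [HasExt.{w} C] (B : C) [Simple B]
    (h : ∀ S : C, Simple S →
      letI := extModule S B 1; Module.Finite (End B) (Abelian.Ext.{w} S B 1))
    {n : ℕ} {X : C} (hX : LengthLE n X) :
    letI := extModule X B 1; Module.Finite (End B) (Abelian.Ext.{w} X B 1) := by
  induction hX with
  | @zero n X hX =>
    let := extModule X B 1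
    have : Subsingleton (Abelian.Ext.{w} X B 1) := ⟨fun a b => by
      have h0 : ∀ e : Abelian.Ext.{w} X B 1, e = 0 := fun e => by
        rw [← Abelian.Ext.mk₀_id_comp e, hX.eq_of_src (𝟙 X) 0, Abelian.Ext.mk₀_zero,
          Abelian.Ext.zero_comp]
      rw [h0 a, h0 b]⟩
    infer_instance
  | step f hf _ hs ih =>
    exact extModule_finite_of_shortExact
      (S := ShortComplex.mk f (cokernel.π f) (cokernel.condition f))
      { exact := ShortComplex.exact_cokernel f } B ih (h _ hs)

/-- For extensions `E` of `X` by `K` such that all maps `E ⟶ B` vanish on `K`, the number of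
`End B`-linearly independent maps `K ⟶ B` is bounded. This is an elementary form of the finiteness
of `Ext¹(X, B)`. -/
def HomBoundedOnExtensions (X B : C) : Prop :=
  ∃ n : ℕ, ∀ {K E : C} (k : K ⟶ E) (p : E ⟶ X) (w : k ≫ p = 0),
    (ShortComplex.mk k p w).ShortExact → (∀ ψ : E ⟶ B, k ≫ ψ = 0) →
    ∀ (m : ℕ) (φ : Fin m → (K ⟶ B)),
      (∀ r : Fin m → (B ⟶ B), ∑ i, φ i ≫ r i = 0 → r = 0) → m ≤ n

/-- Since `Hom(E, B) ⟶ Hom(K, B)` is zero, the connecting map `Hom(K, B) ⟶ Ext¹(X, B)` is injective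
and preserves linear independence. -/
theorem homBoundedOnExtensions_of_finite [HasExt.{w} C] (X B : C) [Simple B]
    (h : letI := extModule X B 1; Module.Finite (End B) (Abelian.Ext.{w} X B 1)) :
    HomBoundedOnExtensions X B := by
  let := extModule X B 1
  refine ⟨Module.finrank (End B) (Abelian.Ext.{w} X B 1), fun {K E} k p w hS hψ m φ hφ => ?_⟩
  have hli : LinearIndependent (End B)
      fun i => hS.extClass.comp (Abelian.Ext.mk₀ (φ i)) (add_zero 1) := by
    rw [Fintype.linearIndependent_iff]
    intro r hr
    have hsum : ∑ i, r i • hS.extClass.comp (Abelian.Ext.mk₀ (φ i)) (add_zero 1) =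
        hS.extClass.comp (Abelian.Ext.mk₀ (∑ i, φ i ≫ r i)) (add_zero 1) := by
      rw [Abelian.Ext.mk₀_sum, Abelian.Ext.comp_sum]
      refine Finset.sum_congr rfl fun i _ => ?_
      change (hS.extClass.comp (Abelian.Ext.mk₀ (φ i)) (add_zero 1)).comp
        (Abelian.Ext.mk₀ (r i)) (add_zero 1) = _
      rw [Abelian.Ext.comp_assoc_of_second_deg_zero, Abelian.Ext.mk₀_comp_mk₀]
    rw [hsum] at hr
    obtain ⟨x, hx⟩ := Abelian.Ext.contravariant_sequence_exact₁ hS B _ (add_zero 1) hr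
    obtain ⟨ψ, rfl⟩ := (Abelian.Ext.mk₀_bijective E B).2 x
    have h0 := (Abelian.Ext.mk₀_bijective K B).1
      ((Abelian.Ext.mk₀_comp_mk₀ k ψ).symm.trans hx)
    exact fun i => congrFun (hφ r (by rw [← h0, hψ])) i
  simpa using hli.fintype_card_le_finrank

/-- All the pairs of an object and a simple object satisfy `HomBoundedOnExtensions`. -/
def HasBoundedExtensions (C : Type u) [Category.{v} C] [Abelian C] : Prop :=
  ∀ X B : C, Simple B → HomBoundedOnExtensions X B

theorem hasBoundedExtensions_of_isExtFinite (hC : IsLengthCategory C) (h : IsExtFinite C 1) :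
    HasBoundedExtensions C := by
  intro X B hB
  let : HasExt.{max u v} C := HasExt.standard C
  obtain ⟨n, hn⟩ := hasSimpleFiltration_iff.1 (hC X)
  exact homBoundedOnExtensions_of_finite X B
    (extModule_finite_of_lengthLE B (fun S hS => h S B hS hB) hn)

/-- The extension and the independent maps are carried over by `F`, so `Ext` groups of different
categories need not be compared. -/
theorem HasBoundedExtensions.of_functor {D : Type u₁} [Category.{v₁} D] [Abelian D]
    (h : HasBoundedExtensions C) (F : D ⥤ C) [F.Full] [F.Faithful] [PreservesFiniteLimits F]
    [PreservesFiniteColimits F] (hF : ∀ S : D, Simple S → Simple (F.obj S)) :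
    HasBoundedExtensions D := by
  have : F.Additive := Functor.additive_of_preserves_binary_products F
  intro X B hB
  obtain ⟨n, hn⟩ := h (F.obj X) (F.obj B) (hF B hB)
  refine ⟨n, fun {K E} k p w hS hψ m φ hφ => ?_⟩
  refine hn (F.map k) (F.map p) (by rw [← F.map_comp, w, F.map_zero])
    (hS.map_of_exact F) (fun ψ => ?_) m (fun i => F.map (φ i)) fun r hr => ?_
  · obtain ⟨ψ, rfl⟩ := F.map_surjective ψ
    rw [← F.map_comp, hψ, F.map_zero]
  · choose s hs using fun i => F.map_surjective (r i)
    have : s = 0 := hφ s (F.map_injective (by simpa [F.map_sum, hs] using hr))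
    funext i
    rw [← hs, this]
    simp

end Ext
-- Bounding length by counting maps to simple objects
section Cover

variable {A : Type u} [Category.{v} A] [Abelian A]

theorem LengthLE.biprod {a c : ℕ} {X Y : A} (hX : LengthLE a X) (hY : LengthLE c Y) :
    LengthLE (a + c) (X ⊞ Y) := by
  refine LengthLE.ext (biprod.snd : X ⊞ Y ⟶ Y) ?_ hY
  have : Mono (kernel.ι (biprod.snd : X ⊞ Y ⟶ Y) ≫ biprod.fst) := by
    refine Preadditive.mono_of_cancel_zero _ fun {T} t ht => ?_
    rw [← cancel_mono (kernel.ι (biprod.snd : X ⊞ Y ⟶ Y))]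
    apply biprod.hom_ext <;> simp [ht]
  exact (hX.sub (kernel.ι (biprod.snd : X ⊞ Y ⟶ Y) ≫ biprod.fst)).1

/-- The length of an object all of whose simple quotients lie in a finite family with projective
covers is bounded in terms of the number of independent maps to these simple objects. -/
theorem LengthLE.of_independent_bounded (hA : IsLengthCategory A) {ι : Type} [Fintype ι]
    {S Q : ι → A} (q : ∀ b, Q b ⟶ S b) [∀ b, Simple (S b)] [∀ b, Projective (Q b)]
    [∀ b, Epi (q b)] {l n : ι → ℕ} (hQ : ∀ b, LengthLE (l b) (Q b)) {K : A}
    (hK : ∀ {T : A} (f : K ⟶ T), Simple T → f ≠ 0 → ∃ b, Nonempty (T ≅ S b))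
    (hn : ∀ (b : ι) (m : ℕ) (φ : Fin m → (K ⟶ S b)),
      (∀ r : Fin m → (S b ⟶ S b), ∑ i, φ i ≫ r i = 0 → r = 0) → m ≤ n b) :
    LengthLE (∑ b, n b * l b) K := by
  classical
  -- `W` is assembled from `c b` copies of each `Q b`. While `g` is not epi, a simple quotient of
  -- its cokernel gives a map `φ₀` that is zero on `W` but not on one further `Q b`; asking for
  -- independence after restriction along `g` therefore survives the step.
  have key : ∀ m : ℕ, ∃ (W : A) (g : W ⟶ K) (c : ι → ℕ), LengthLE (∑ b, c b * l b) W ∧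
      (∀ b, ∃ φ : Fin (c b) → (K ⟶ S b),
        ∀ r : Fin (c b) → (S b ⟶ S b), g ≫ ∑ i, φ i ≫ r i = 0 → r = 0) ∧
      (Epi g ∨ m ≤ ∑ b, c b) := by
    intro m
    induction m with
    | zero =>
      exact ⟨kernel (𝟙 K), 0, fun _ => 0, .zero (isZero_kernel_of_mono _),
        fun b => ⟨fun _ => 0, fun r _ => Subsingleton.elim _ _⟩, Or.inr (Nat.zero_le _)⟩
    | succ m ih =>
      obtain ⟨W, g, c, hW, hφ, hg⟩ := ih
      by_cases hepi : Epi g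
      · exact ⟨W, g, c, hW, hφ, Or.inl hepi⟩
      have hm := hg.resolve_left hepi
      have hV : ¬ IsZero (cokernel g) := fun h =>
        hepi (Preadditive.epi_of_cokernel_zero (h.eq_of_tgt _ _))
      obtain ⟨N, hN⟩ := hasSimpleFiltration_iff.1 (hA (cokernel g))
      obtain ⟨T, t, hT, ht⟩ := hN.exists_simple_quotient hV
      have ht0 : cokernel.π g ≫ t ≠ 0 := fun h => Simple.not_isZero T
        (IsZero.of_epi_eq_zero _ h)
      obtain ⟨b, ⟨e⟩⟩ := hK (cokernel.π g ≫ t) hT ht0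
      let φ₀ : K ⟶ S b := cokernel.π g ≫ t ≫ e.hom
      have hgφ : g ≫ φ₀ = 0 := by simp [φ₀]
      have : Epi φ₀ := by
        have : Epi (t ≫ e.hom) := epi_comp _ _
        exact epi_comp _ _
      let q₀ : Q b ⟶ K := Projective.factorThru (q b) φ₀
      have hq₀ : q₀ ≫ φ₀ = q b := Projective.factorThru_comp _ _
      have hsum : ∀ f : ι → ℕ, ∑ x, Function.update c b (c b + 1) x * f x =
          ∑ x, c x * f x + f b := by
        intro f
        have : ∀ x, Function.update c b (c b + 1) x * f x =
            c x * f x + if x = b then f b else 0 := by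
          intro x
          by_cases hx : x = b
          · subst hx; simp; ring
          · simp [hx]
        simp [this, Finset.sum_add_distrib]
      refine ⟨W ⊞ Q b, biprod.desc g q₀, Function.update c b (c b + 1), ?_, fun b' => ?_,
        Or.inr ?_⟩
      · rw [hsum]
        exact hW.biprod (hQ b)
      · by_cases hb : b' = b
        · subst hb
          rw [Function.update_self]
          obtain ⟨φ, hφ⟩ := hφ b'
          refine ⟨Fin.cons φ₀ φ, fun r hr => ?_⟩
          rw [Fin.sum_univ_succ, Preadditive.comp_add] at hr
          simp only [Fin.cons_zero, Fin.cons_succ] at hr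
          have h1 : Fin.tail r = 0 := by
            apply hφ
            have := biprod.inl ≫= hr
            simpa [reassoc_of% hgφ, Fin.tail] using this
          have h2 : ∀ i : Fin (c b'), r i.succ = 0 := fun i => congrFun h1 i
          have h3 : r 0 = 0 := by
            have := biprod.inr ≫= hr
            simp only [h2, comp_zero, Finset.sum_const_zero, add_zero, biprod.inr_desc_assoc,
              reassoc_of% hq₀] at this
            rw [← cancel_epi (q b'), this, comp_zero]
          funext i
          refine Fin.cases h3 h2 i
        · rw [Function.update_of_ne hb]
          obtain ⟨φ, hφ⟩ := hφ b'
          refine ⟨φ, fun r hr => hφ r ?_⟩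
          have := biprod.inl ≫= hr
          simpa using this
      · have := hsum fun _ => 1
        simp only [mul_one] at this
        omega
  -- One more than the independence bounds allow, so `g` must be epi.
  obtain ⟨W, g, c, hW, hφ, hg⟩ := key (∑ b, n b + 1)
  have hc : ∀ b, c b ≤ n b := by
    intro b
    obtain ⟨φ, hφ⟩ := hφ b
    exact hn b _ φ fun r hr => hφ r (by rw [hr, comp_zero])
  have hg' : Epi g := by
    refine hg.resolve_right fun h => ?_
    have := Finset.sum_le_sum fun b (_ : b ∈ Finset.univ) => hc b
    omega
  exact (hW.quot g).1.mono (Finset.sum_le_sum fun b _ => Nat.mul_le_mul_right _ (hc b))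

end Cover

/-! ### Ascent of projective covers in a recollement -/

namespace Recollement

variable {AZ : Type u₁} [Category.{v₁} AZ] [Abelian AZ] {A : Type u} [Category.{v} A] [Abelian A]
  {iLow : AZ ⥤ A} {AU : Type u₂} [Category.{v₂} AU] [Abelian AU]

theorem simple_jStar (R : Recollement iLow AU) {T : A} [Simple T]
    (hT : ¬ IsZero (R.jStar.obj T)) : Simple (R.jStar.obj T) := by
  constructor
  intro Y f hf
  constructor
  · rintro h rfl
    exact hT (IsZero.of_epi_eq_zero (0 : Y ⟶ R.jStar.obj T) rfl)
  · intro hf0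
    have h0 : (R.adjJShriek.homEquiv Y T).symm f ≠ 0 := by
      intro h
      apply hf0
      rw [← (R.adjJShriek.homEquiv Y T).apply_symm_apply f, h, Adjunction.homEquiv_unit]
      simp
    have : Epi ((R.adjJShriek.homEquiv Y T).symm f) := epi_of_nonzero_to_simple h0
    have : Epi f := by
      rw [← (R.adjJShriek.homEquiv Y T).apply_symm_apply f, Adjunction.homEquiv_unit]
      exact epi_comp _ _
    exact isIso_of_mono_of_epi f

/-- Both objects embed in `j_* j^* T'`. The cokernel of the embedding of `T'` is killed by `j^*`, so
the simple `T` maps to zero in it and factors through `T'`. -/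
theorem nonempty_iso_of_jStar (R : Recollement iLow AU) {T T' : A} [Simple T] [Simple T']
    (hT : ¬ IsZero (R.jStar.obj T)) (e : R.jStar.obj T ≅ R.jStar.obj T') : Nonempty (T ≅ T') := by
  let η : T' ⟶ R.jLow.obj (R.jStar.obj T') := R.adjJLow.unit.app T'
  let f : T ⟶ R.jLow.obj (R.jStar.obj T') := R.adjJLow.homEquiv _ _ e.hom
  have hη : η ≠ 0 := by
    intro h
    apply hT
    have h1 := R.adjJLow.left_triangle_components T'
    change R.jStar.map η ≫ _ = _ at h1
    rw [h, R.jStar.map_zero, zero_comp] at h1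
    exact ((IsZero.iff_id_eq_zero _).2 h1.symm).of_iso e
  have hf : f ≠ 0 := by
    intro h
    have h1 : e.hom = 0 := by
      rw [← (R.adjJLow.homEquiv _ _).symm_apply_apply e.hom]
      change (R.adjJLow.homEquiv _ _).symm f = 0
      rw [h, Adjunction.homEquiv_counit]
      simp
    exact hT (IsZero.of_mono_eq_zero _ h1)
  have : Mono η := mono_of_nonzero_from_simple hη
  have : Mono f := mono_of_nonzero_from_simple hf
  have h1 : Epi (R.jStar.map η) := by
    have h1 := R.adjJLow.left_triangle_components T'
    have : R.jStar.map η = inv (R.adjJLow.counit.app (R.jStar.obj T')) :=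
      (IsIso.inv_eq_of_inv_hom_id h1).symm
    rw [this]; infer_instance
  have h2 : f ≫ cokernel.π η = 0 := by
    by_contra h
    have : Mono (f ≫ cokernel.π η) := mono_of_nonzero_from_simple h
    exact hT (R.isZero_jStar_of_mono (f ≫ cokernel.π η) (R.isZero_jStar_cokernel η))
  have h3 := Abelian.monoLift_comp η f h2
  have : IsIso (Abelian.monoLift η f h2) := (isIso_iff_nonzero _).2 (by
    intro h
    rw [h, zero_comp] at h3
    exact hf h3.symm)
  exact ⟨asIso (Abelian.monoLift η f h2)⟩

theorem isIso_jStar_kernel (R : Recollement iLow AU) {E X : A} (p : E ⟶ X)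
    (hX : IsZero (R.jStar.obj X)) : IsIso (R.jStar.map (kernel.ι p)) := by
  have h : R.jStar.map p = 0 := hX.eq_of_tgt _ _
  have hs : kernel.lift (R.jStar.map p) (𝟙 _) (by rw [h, comp_zero]) ≫ kernel.ι _ = 𝟙 _ :=
    kernel.lift_ι _ _ _
  have : IsSplitEpi (kernel.ι (R.jStar.map p)) := ⟨⟨⟨_, hs⟩⟩⟩
  have : IsIso (kernel.ι (R.jStar.map p)) := isIso_of_mono_of_isSplitEpi _
  rw [← kernelComparison_comp_ι]
  infer_instance

/-- The kernel of an essential epimorphism onto the image of a projective object of the closed part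
has no simple quotient in the closed part. -/
theorem eq_zero_of_kernel_essentialEpi (R : Recollement iLow AU) {P : AZ} [Projective P] {E : A}
    {p : E ⟶ iLow.obj P} (hp : EssentialEpi p) {T : A} (hT : IsZero (R.jStar.obj T))
    (f : kernel p ⟶ T) : f = 0 := by
  have := R.iLow_full
  have := R.iLow_faithful
  have := hp.epi
  let n := kernel.ι f ≫ kernel.ι p
  have : Mono n := mono_comp _ _
  have hnp : n ≫ p = 0 := by simp [n]
  let p' : cokernel n ⟶ iLow.obj P := cokernel.desc n p hnp
  have hπ : cokernel.π n ≫ p' = p := cokernel.π_desc _ _ _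
  have hp' : EssentialEpi p' := EssentialEpi.of_comp (q := cokernel.π n) (by rwa [hπ])
  have := hp'.epi
  have h1 : Epi (R.jStar.map n) := by
    have := R.isIso_jStar_kernel f hT
    have := R.isIso_jStar_kernel p (R.jStar_iLow P)
    rw [R.jStar.map_comp]
    infer_instance
  -- The quotient of `E` by `kernel f` comes from the closed part, so its epimorphism onto `iLow.obj
  -- P` splits; being essential it is invertible, whence `kernel p` lies in `kernel f`.
  let e := R.isoOfIsZero (R.isZero_jStar_cokernel n)
  obtain ⟨g, hg⟩ := iLow.map_surjective (e.inv ≫ p')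
  have : Epi (iLow.map g) := by rw [hg]; exact epi_comp _ _
  have : Epi g := iLow.epi_of_epi_map this
  have hs : Projective.factorThru (𝟙 P) g ≫ g = 𝟙 P := Projective.factorThru_comp _ _
  have : IsIso p' := hp'.isIso_of_section (iLow.map (Projective.factorThru (𝟙 P) g) ≫ e.inv) (by
    rw [Category.assoc, ← hg, ← iLow.map_comp, hs, iLow.map_id])
  have h2 : kernel.ι p ≫ cokernel.π n = 0 := by
    rw [← cancel_mono p', Category.assoc, hπ, kernel.condition, zero_comp]
  have h3 := Abelian.monoLift_comp n _ h2
  have h4 : Abelian.monoLift n _ h2 ≫ kernel.ι f = 𝟙 _ := by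
    rw [← cancel_mono (kernel.ι p), Category.assoc, h3, Category.id_comp]
  rw [← Category.id_comp f, ← h4, Category.assoc, kernel.condition, comp_zero]

theorem exists_simple_family (R : Recollement iLow AU) (hs : HasFinitelyManySimples AU)
    (hU : HasProjectiveCovers AU) :
    ∃ (ι : Type) (_ : Fintype ι) (S Q : ι → A) (q : ∀ b, Q b ⟶ S b), (∀ b, Simple (S b)) ∧
      (∀ b, Projective (Q b)) ∧ (∀ b, Epi (q b)) ∧
      ∀ T : A, Simple T → ¬ IsZero (R.jStar.obj T) → ∃ b, Nonempty (T ≅ S b) := by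
  classical
  obtain ⟨n, L, hL⟩ := hs
  -- Only those simples of `AU` that are `j^*` of a simple object of `A` are indexed.
  let ι := {b : Fin n // ∃ T : A, Simple T ∧ ¬ IsZero (R.jStar.obj T) ∧
    Nonempty (R.jStar.obj T ≅ L b)}
  choose S hS hS0 hSL using fun b : ι => b.2
  choose P p hp using fun b : ι => hU (R.jStar.obj (S b))
  refine ⟨ι, inferInstance, S, fun b => R.jShriek.obj (P b),
    fun b => (R.adjJShriek.homEquiv _ _).symm (p b), hS, fun b => ?_, fun b => ?_, ?_⟩
  · exact R.adjJShriek.map_projective _ (hp b).projective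
  · have := hS b
    refine epi_of_nonzero_to_simple fun h => hS0 b ?_
    have := (hp b).epi
    refine IsZero.of_epi_eq_zero (p b) ?_
    dsimp only at h
    rw [← (R.adjJShriek.homEquiv _ _).apply_symm_apply (p b), h, Adjunction.homEquiv_unit]
    simp
  · intro T hT hT0
    obtain ⟨b, ⟨e⟩⟩ := hL _ (R.simple_jStar hT0)
    let b' : ι := ⟨b, T, hT, hT0, ⟨e⟩⟩
    obtain ⟨e'⟩ := hSL b'
    have := hS b'
    exact ⟨b', R.nonempty_iso_of_jStar hT0 (e ≪≫ e'.symm)⟩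

theorem hasProjectiveCovers (R : Recollement iLow AU) (hA : IsLengthCategory A)
    (hb : HasBoundedExtensions A) (hs : HasFinitelyManySimples AU) (hZ : HasProjectiveCovers AZ)
    (hU : HasProjectiveCovers AU) : HasProjectiveCovers A := by
  have := R.preservesFiniteColimits_iLow
  obtain ⟨ι, _, S, Q, q, hS, hQ, hq, hSQ⟩ := R.exists_simple_family hs hU
  have hlen : ∀ X : A, ∃ n, LengthLE n X := fun X => hasSimpleFiltration_iff.1 (hA X)
  have hclosed : ∀ P : AZ, Projective P →
      ∃ (G : A) (p : G ⟶ iLow.obj P), IsProjectiveCover p := by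
    intro P hP
    choose l hl using fun b => hlen (Q b)
    choose n hn using fun b => hb (iLow.obj P) (S b) (hS b)
    obtain ⟨x, hx⟩ := hlen (iLow.obj P)
    refine exists_isProjectiveCover_of_bounded hA (N := ∑ b, n b * l b + x) fun {E} p hp => ?_
    have := hp.epi
    refine LengthLE.ext p ?_ hx
    refine LengthLE.of_independent_bounded hA q hl (fun {T} f hT hf => ?_) fun b m φ hφ => ?_
    · exact hSQ T hT fun h => hf (R.eq_zero_of_kernel_essentialEpi hp h f)
    · exact hn b (kernel.ι p) p (kernel.condition p) { exact := ShortComplex.exact_kernel p }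
        (fun ψ => hp.kernel_comp_eq_zero ψ) m φ hφ
  refine hasProjectiveCovers_of_length hA fun Y => ?_
  obtain ⟨P, p, hp⟩ := hZ (R.iStar.obj Y)
  obtain ⟨G, g, hg⟩ := hclosed P hp.projective
  obtain ⟨V, r, hr⟩ := hU (R.jStar.obj Y)
  have := hp.epi
  have := hg.epi
  have := hr.epi
  have := hg.projective
  have : Projective (R.jShriek.obj V) := R.adjJShriek.map_projective _ hr.projective
  obtain ⟨⟨w, hex⟩, hepi⟩ := R.exact_right Y
  let g' : G ⟶ Y := Projective.factorThru (g ≫ iLow.map p) (R.adjIStar.unit.app Y)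
  have hg' : g' ≫ R.adjIStar.unit.app Y = g ≫ iLow.map p := Projective.factorThru_comp _ _
  refine ⟨G ⊞ R.jShriek.obj V,
    biprod.desc g' (R.jShriek.map r ≫ R.adjJShriek.counit.app Y), inferInstance, ?_⟩
  refine Preadditive.epi_of_cancel_zero _ fun {Z} c hc => ?_
  have h1 : g' ≫ c = 0 := by simpa using biprod.inl ≫= hc
  have h2 : R.adjJShriek.counit.app Y ≫ c = 0 := by
    have := biprod.inr ≫= hc
    rw [biprod.inr_desc_assoc, comp_zero, Category.assoc] at this
    rw [← cancel_epi (R.jShriek.map r), this, comp_zero]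
  have hd : R.adjIStar.unit.app Y ≫ hex.desc c h2 = c := hex.g_desc c h2
  have h3 : (g ≫ iLow.map p) ≫ hex.desc c h2 = 0 := by
    rw [← hg', Category.assoc, hd, h1]
  have : Epi (g ≫ iLow.map p) := epi_comp _ _
  have h4 : hex.desc c h2 = 0 := by rw [← cancel_epi (g ≫ iLow.map p), h3, comp_zero]
  rw [← hd, h4, comp_zero]

end Recollement
-- Duality
section Opposite

open Opposite

variable {C : Type u} [Category.{v} C] [Abelian C]

theorem simple_op (X : C) [Simple X] : Simple (op X) := by
  refine simple_of_cosimple _ fun {Z} f _ => ?_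
  rw [← isIso_unop_iff, Simple.mono_isIso_iff_nonzero, ne_eq, ne_eq, not_iff_not]
  exact ⟨fun h => Quiver.Hom.unop_inj h, fun h => by rw [h]; rfl⟩

theorem simple_unop (X : Cᵒᵖ) [Simple X] : Simple X.unop := by
  have := simple_op X
  exact simple_obj (opOpEquivalence C).functor (op X)

theorem IsLengthCategory.op (h : IsLengthCategory C) : IsLengthCategory Cᵒᵖ := by
  intro X
  obtain ⟨n, hn⟩ := hasSimpleFiltration_iff.1 (h X.unop)
  suffices ∀ (n : ℕ) (Y : C), LengthLE n Y → LengthLE n (Opposite.op Y) from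
    hasSimpleFiltration_iff.2 ⟨n, this n _ hn⟩
  intro n Y hY
  induction hY with
  | zero h => exact .zero h.op
  | step f hf _ hs ih =>
    have := simple_op (cokernel f)
    exact (LengthLE.ext f.op ((LengthLE.of_simple _).of_iso (kernelOpOp f).symm) ih).mono
      (by omega)

theorem HasFinitelyManySimples.op (h : HasFinitelyManySimples C) : HasFinitelyManySimples Cᵒᵖ := by
  obtain ⟨n, L, hL⟩ := h
  refine ⟨n, fun i => Opposite.op (L i), fun X _ => ?_⟩
  obtain ⟨i, ⟨e⟩⟩ := hL X.unop (simple_unop X)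
  exact ⟨i, ⟨e.symm.op⟩⟩

theorem hasProjectiveCovers_op_iff : HasProjectiveCovers Cᵒᵖ ↔ HasInjectiveEnvelopes C := by
  constructor
  · intro h X
    obtain ⟨P, p, hp⟩ := h (Opposite.op X)
    have := hp.projective
    have := hp.epi
    refine ⟨P.unop, p.unop, inferInstance, inferInstance, fun {Y} a ha => ?_⟩
    have : Epi (a.op ≫ p) := by
      have : a.op ≫ p = (p.unop ≫ a).op := rfl
      rw [this]; infer_instance
    have := hp.essential a.op this
    exact unop_mono_of_epi a.op
  · intro h X
    obtain ⟨I, i, hi⟩ := h X.unop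
    have := hi.injective
    have := hi.mono
    refine ⟨Opposite.op I, i.op, inferInstance, (inferInstance : Epi i.op), fun {Y} a ha => ?_⟩
    have : Mono (i ≫ a.unop) := unop_mono_of_epi (a ≫ i.op)
    have := hi.essential a.unop this
    exact op_epi_of_mono a.unop

end Opposite

/-- The opposite of a recollement. -/
def Recollement.op {AZ : Type u₁} [Category.{v₁} AZ] [Abelian AZ] {A : Type u} [Category.{v} A]
    [Abelian A] {iLow : AZ ⥤ A} {AU : Type u₂} [Category.{v₂} AU] [Abelian AU]
    (R : Recollement iLow AU) : Recollement iLow.op AUᵒᵖ where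
  iStar := R.iShriek.op
  iShriek := R.iStar.op
  jStar := R.jStar.op
  jShriek := R.jLow.op
  jLow := R.jShriek.op
  adjIStar := R.adjIShriek.op
  adjIShriek := R.adjIStar.op
  adjJShriek := R.adjJLow.op
  adjJLow := R.adjJShriek.op
  iLow_full := have := R.iLow_full; inferInstance
  iLow_faithful := have := R.iLow_faithful; inferInstance
  jShriek_full := inferInstance
  jShriek_faithful := inferInstance
  jLow_full := inferInstance
  jLow_faithful := inferInstance
  jStar_iLow X := (R.jStar_iLow X.unop).op
  exact_right X := by
    obtain ⟨⟨w, h⟩, hm⟩ := R.exact_left X.unop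
    exact ⟨⟨congrArg Quiver.Hom.op w, h.op⟩, op_epi_of_mono (R.adjIShriek.counit.app X.unop)⟩
  exact_left X := by
    obtain ⟨⟨w, h⟩, hm⟩ := R.exact_right X.unop
    exact ⟨⟨congrArg Quiver.Hom.op w, h.op⟩, op_mono_of_epi (R.adjIStar.unit.app X.unop)⟩

/-! ### Induction over lower sets -/

section LowerSets

variable {Λ : Type w} [PartialOrder Λ] [Finite Λ]

/-- Induction on lower sets of a finite poset by adding maximal elements. -/
theorem lowerSet_induction {P : LowerSet Λ → Prop} (bot : P ⊥)
    (step : ∀ (s : LowerSet Λ) (l : Λ) (h : Maximal (· ∈ s) l), P (removeMaximal s l h) → P s)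
    (s : LowerSet Λ) : P s := by
  induction hn : (s : Set Λ).ncard using Nat.strong_induction_on generalizing s with
  | _ n ih =>
    rcases (s : Set Λ).eq_empty_or_nonempty with h | h
    · have : s = ⊥ := SetLike.coe_injective (by simpa using h)
      exact this ▸ bot
    · obtain ⟨l, hl⟩ := (Set.toFinite (s : Set Λ)).exists_maximal h
      refine step s l hl (ih _ ?_ _ rfl)
      rw [← hn]
      exact Set.ncard_lt_ncard ⟨fun m hm => hm.1, fun hs => (hs hl.1).2 rfl⟩ (Set.toFinite _)

/-- Induction on lower sets of a finite poset by removing maximal elements. -/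
theorem lowerSet_coinduction {P : LowerSet Λ → Prop} (top : P ⊤)
    (step : ∀ (s : LowerSet Λ) (l : Λ) (h : Maximal (· ∈ s) l), P s → P (removeMaximal s l h))
    (s : LowerSet Λ) : P s := by
  induction hn : ((s : Set Λ)ᶜ).ncard using Nat.strong_induction_on generalizing s with
  | _ n ih =>
    rcases ((s : Set Λ)ᶜ).eq_empty_or_nonempty with h | h
    · have : s = ⊤ := SetLike.coe_injective (by simpa using h)
      exact this ▸ top
    · obtain ⟨l, hl⟩ := (Set.toFinite ((s : Set Λ)ᶜ)).exists_minimal h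
      let t : LowerSet Λ :=
        { carrier := insert l (s : Set Λ)
          lower' := by
            rintro a b hba (rfl | ha)
            · by_cases hb : b ∈ s
              · exact Or.inr hb
              · exact Or.inl (le_antisymm hba (hl.2 hb hba))
            · exact Or.inr (s.lower hba ha) }
      have ht : Maximal (· ∈ t) l := by
        refine ⟨Or.inl rfl, ?_⟩
        rintro m (rfl | hm) hlm
        · exact le_rfl
        · exact (hl.1 (s.lower hlm hm)).elim
      have hts : removeMaximal t l ht = s := by
        ext m
        constructor
        · rintro ⟨rfl | hm, hml⟩
          · exact (hml rfl).elim
          · exact hm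
        · intro hm
          refine ⟨Or.inr hm, ?_⟩
          rintro rfl
          exact hl.1 hm
      rw [← hts]
      refine step t l ht (ih _ ?_ _ rfl)
      rw [← hn]
      exact Set.ncard_lt_ncard
        ⟨fun m hm hms => hm (Or.inr hms), fun hs => hs hl.1 (Or.inl rfl)⟩ (Set.toFinite _)

/-- Shows that every stratum is the open part of some recollement. -/
theorem maximal_mem_Iic (l : Λ) : Maximal (· ∈ LowerSet.Iic l) l :=
  ⟨le_rfl, fun _ hm _ => hm⟩

end LowerSets

/-! ### Assembling the recollements of a stratification -/

namespace Stratification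

variable {A : Type u} [Category.{v} A] [Abelian A] {Λ : Type w} [PartialOrder Λ]

/-- The opposite of a stratification. -/
def op (S : Stratification.{v, u, v₁, u₁, v₂, u₂, w} A Λ) :
    Stratification.{v, u, v₁, u₁, v₂, u₂, w} Aᵒᵖ Λ where
  cat s := (S.cat s)ᵒᵖ
  incl h := (S.incl h).op
  incl_full h := have := S.incl_full h; inferInstance
  incl_faithful h := have := S.incl_faithful h; inferInstance
  stratum l := (S.stratum l)ᵒᵖ
  cat_bot X := (S.cat_bot X.unop).op
  catTop := S.catTop.op
  recollement s l h := (S.recollement s l h).op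
  incl_jStar {s t} hst l hs ht := (S.incl_jStar hst l hs ht).map fun e =>
    (NatIso.op e.symm : (S.incl hst ⋙ (S.recollement t l ht).jStar).op ≅
      (S.recollement s l hs).jStar.op)

variable [Finite Λ]

theorem isLengthCategory_cat (S : Stratification.{v, u, v₁, u₁, v₂, u₂, w} A Λ)
    (hlength : ∀ l, IsLengthCategory (S.stratum l)) (s : LowerSet Λ) :
    IsLengthCategory (S.cat s) := by
  induction s using lowerSet_induction with
  | bot => exact fun X => .zero (S.cat_bot X)
  | step s l h ih => exact (S.recollement s l h).isLengthCategory ih (hlength l)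

theorem hasProjectiveCovers_iff (S : Stratification.{v, u, v₁, u₁, v₂, u₂, w} A Λ)
    (hlength : ∀ l, IsLengthCategory (S.stratum l))
    (hsimples : ∀ l, HasFinitelyManySimples (S.stratum l)) (hA : IsExtFinite A 1) :
    HasProjectiveCovers A ↔ ∀ l, HasProjectiveCovers (S.stratum l) := by
  have hcat := S.isLengthCategory_cat hlength
  have hAlen : IsLengthCategory A := (hcat ⊤).of_equivalence S.catTop
  constructor
  · intro h l
    have hc : ∀ s, HasProjectiveCovers (S.cat s) := fun s => by
      induction s using lowerSet_coinduction with
      | top => exact h.of_equivalence hAlen S.catTop.symm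
      | step s l hl ih => exact (S.recollement s l hl).hasProjectiveCovers_closed (hcat _) ih
    exact (S.recollement _ l (maximal_mem_Iic l)).hasProjectiveCovers_open (hlength l) (hc _)
  · intro h
    -- The extension bound descends from `A`, whereas the covers below are built up from the empty
    -- lower set.
    have hb : ∀ s, HasBoundedExtensions (S.cat s) := fun s => by
      induction s using lowerSet_coinduction with
      | top =>
        exact (hasBoundedExtensions_of_isExtFinite hAlen hA).of_functor S.catTop.functor
          fun X _ => simple_obj S.catTop.functor X
      | step s l hl ih =>
        let R := S.recollement s l hl
        have := R.iLow_full
        have := R.iLow_faithful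
        have := R.preservesFiniteLimits_iLow
        have := R.preservesFiniteColimits_iLow
        exact ih.of_functor (S.incl (removeMaximal_le s l hl)) fun X _ => R.simple_iLow X
    have hc : ∀ s, HasProjectiveCovers (S.cat s) := fun s => by
      induction s using lowerSet_induction with
      | bot =>
        exact fun X => ⟨X, 𝟙 X, (isProjectiveCover_iff _).2
          ⟨(S.cat_bot X).projective, EssentialEpi.id X⟩⟩
      | step s l hl ih =>
        exact (S.recollement s l hl).hasProjectiveCovers (hcat s) (hb s) (hsimples l) ih (h l)
    exact (hc ⊤).of_equivalence (hcat ⊤) S.catTop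

end Stratification
end AbStrat

theorem corollary4p7 {A : Type u} [CategoryTheory.Category.{v} A]
    [CategoryTheory.Abelian A] {Λ : Type w} [PartialOrder Λ] [Finite Λ] [Nonempty Λ]
    (S : AbStrat.Stratification.{v, u, v₁, u₁, v₂, u₂, w} A Λ)
    (hlength : ∀ l : Λ, AbStrat.IsLengthCategory (S.stratum l))
    (hsimples : ∀ l : Λ, AbStrat.HasFinitelyManySimples (S.stratum l)) :
    (AbStrat.IsExtFinite A 1 →
      (AbStrat.HasProjectiveCovers A ↔ ∀ l : Λ, AbStrat.HasProjectiveCovers (S.stratum l))) ∧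
    (AbStrat.IsExtFinite Aᵒᵖ 1 →
      (AbStrat.HasInjectiveEnvelopes A ↔
        ∀ l : Λ, AbStrat.HasInjectiveEnvelopes (S.stratum l))) := by
  refine ⟨fun h => S.hasProjectiveCovers_iff hlength hsimples h, fun h => ?_⟩
  have := S.op.hasProjectiveCovers_iff (fun l => (hlength l).op) (fun l => (hsimples l).op) h
  rw [AbStrat.hasProjectiveCovers_op_iff] at this
  exact this.trans (forall_congr' fun l => AbStrat.hasProjectiveCovers_op_iff)
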